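/- Let $V:\mathbb{R}^d\to\mathbb{R}$ be twice differentiable with $\alpha I\preceq\nabla^2V(x)\preceq\beta I$ for all $x\in\mathbb{R}^d$, where $\alpha,\beta\in\mathbb{R}$. Let $h>0$, let $N\ge 1$ be an integer, and put $L=\max(|1-h\alpha|,|1-h\beta|)$. Let $\hat P_h$ be the Markov kernel of the discretized Langevin diffusion with step size $h$, that is, $\hat P_h(x,\cdot)=\mathcal N(x-h\nabla V(x),\,2hI)$. Put $$C=\frac{1-L^2}{4h\,(L^{-2N}-1)},$$ where for $L=1$ and $L=0$ the expression is read as its limits $\frac1{4hN}$ and $0$, respectively. Then for all Borel probability measures $\mu,\nu$ on $\mathbb{R}^d$, $$\mathsf{KL}(\mu\hat P_h^N\,\|\,\nu\hat P_h^N)\le C\,W_2^2(\mu,\nu)$$ (with the convention $0\cdot\infty=0$ on the right-hand side), and for every $q\in(0,1)\cup(1,\infty)$, $$\mathsf{R}_q(\mu\hat P_h^N\,\|\,\nu\hat P_h^N)\le\inf_{\gamma\in\mathscr C(\mu,\nu)}\frac1{q-1}\log\int\exp\bigl(q(q-1)\,C\,\|x-y\|^2\bigr)\,\gamma(\mathrm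 dx,\mathrm dy).$$ Here $\mathscr C(\mu,\nu)$ is the set of couplings of $\mu$ and $\nu$, $W_2^2(\mu,\nu)=\inf_{\gamma\in\mathscr C(\mu,\nu)}\int\|x-y\|^2\,\gamma(\mathrm dx,\mathrm dy)\in[0,\infty]$, and $\mathsf R_q$ is the Rényi divergence of order $q$: $\mathsf R_q(\mu\|\nu)=\frac1{q-1}\log\int(\frac{\mathrm d\mu}{\mathrm d\nu})^q\,\mathrm d\nu$ if $\mu\ll\nu$; otherwise $\mathsf R_q(\mu\|\nu)=+\infty$ for $q>1$ and $\mathsf R_q(\mu\|\nu)=\frac1{q-1}\log\int(\frac{\mathrm d\mu}{\mathrm d\lambda})^q(\frac{\mathrm d\nu}{\mathrm d\lambda})^{1-q}\,\mathrm d\lambda$ with $\lambda=\mu+\nu$ for $q<1$, all with values in $[0,\infty]$ (and $\log 0=-\infty$, $\log\infty=\infty$). -/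

import Mathlib

open MeasureTheory ProbabilityTheory InformationTheory
open scoped ENNReal

noncomputable section

namespace LangevinRegularity

open scoped MatrixOrder in
/-- The heat semigroup on `ℝ^d` as a family of Markov kernels: `Q_t(x, ·) = N(x, t I)`. -/
def heatKernel (d : ℕ) (t : ℝ) :
    Kernel (EuclideanSpace ℝ (Fin d)) (EuclideanSpace ℝ (Fin d)) where
  toFun x := multivariateGaussian x (t • (1 : Matrix (Fin d) (Fin d) ℝ))
  measurable' := by
    refine Measure.measurable_of_measurable_coe _ fun s hs => ?_
    have h : ∀ x : EuclideanSpace ℝ (Fin d),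
        multivariateGaussian x (t • (1 : Matrix (Fin d) (Fin d) ℝ)) s =
          ∫⁻ z, s.indicator 1 (x + Matrix.toEuclideanCLM (𝕜 := ℝ)
            (CFC.sqrt (t • (1 : Matrix (Fin d) (Fin d) ℝ))) z)
            ∂(stdGaussian (EuclideanSpace ℝ (Fin d))) := by
      intro x
      rw [multivariateGaussian, ← lintegral_indicator_one hs,
        lintegral_map (measurable_one.indicator hs) (by fun_prop)]
    simp_rw [h]
    refine Measurable.lintegral_prod_right' (f := fun p : EuclideanSpace ℝ (Fin d) ×
      EuclideanSpace ℝ (Fin d) => s.indicator 1 (p.1 + Matrix.toEuclideanCLM (𝕜 := ℝ)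
            (CFC.sqrt (t • (1 : Matrix (Fin d) (Fin d) ℝ))) p.2)) ?_
    exact (measurable_one.indicator hs).comp (by fun_prop)

theorem measurable_gradient {d : ℕ} (V : EuclideanSpace ℝ (Fin d) → ℝ) :
    Measurable (gradient V) :=
  (InnerProductSpace.toDual ℝ (EuclideanSpace ℝ (Fin d))).symm.continuous.measurable.comp
    (measurable_fderiv ℝ V)

/-- The kernel of the discretized Langevin diffusion with potential `V` and step size `h`:
`P̂_h(x, ·) = Q_{2h}(x - h ∇V(x), ·)`. -/
def langevinKernel {d : ℕ} (V : EuclideanSpace ℝ (Fin d) → ℝ) (h : ℝ) :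
    Kernel (EuclideanSpace ℝ (Fin d)) (EuclideanSpace ℝ (Fin d)) :=
  (heatKernel d (2 * h)).comap (fun x => x - h • gradient V x)
    (measurable_id.sub ((measurable_gradient V).const_smul h))

/-- The law `μ P̂_h^N` after `N` steps of the discretized Langevin chain started from `μ`. -/
def langevinLaw {d : ℕ} (V : EuclideanSpace ℝ (Fin d) → ℝ) (h : ℝ) (N : ℕ)
    (μ : Measure (EuclideanSpace ℝ (Fin d))) : Measure (EuclideanSpace ℝ (Fin d)) :=
  Measure.bind μ ⇑(langevinKernel V h ^ N)

/-- The Hessian `∇²V(x)`, as the derivative of the gradient field. -/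
def hessian {d : ℕ} (V : EuclideanSpace ℝ (Fin d) → ℝ) (x : EuclideanSpace ℝ (Fin d)) :
    EuclideanSpace ℝ (Fin d) →L[ℝ] EuclideanSpace ℝ (Fin d) :=
  fderiv ℝ (gradient V) x

/-- The couplings of `μ` and `ν`: measures on the product with marginals `μ` and `ν`. -/
def couplings {Ω₁ Ω₂ : Type*} [MeasurableSpace Ω₁] [MeasurableSpace Ω₂]
    (μ : Measure Ω₁) (ν : Measure Ω₂) : Set (Measure (Ω₁ × Ω₂)) :=
  {γ | γ.map Prod.fst = μ ∧ γ.map Prod.snd = ν}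

/-- The `2`-Wasserstein distance, with values in `[0, ∞]`. -/
def wasserstein2 {d : ℕ} (μ ν : Measure (EuclideanSpace ℝ (Fin d))) : ℝ≥0∞ :=
  (⨅ γ ∈ couplings μ ν, ∫⁻ p, ENNReal.ofReal (‖p.1 - p.2‖ ^ 2) ∂γ) ^ (1 / 2 : ℝ)

open Classical in
/-- The Rényi divergence of order `q ∈ (0, ∞)`, with values in the extended reals. Here
`ENNReal.log 0 = ⊥` and `ENNReal.log ∞ = ⊤`. -/
def renyiDiv {Ω : Type*} [MeasurableSpace Ω] (q : ℝ) (μ ν : Measure Ω) : EReal :=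
  if q = 1 then (klDiv μ ν : EReal)
  else if μ ≪ ν then
    (((q - 1)⁻¹ : ℝ) : EReal) * ENNReal.log (∫⁻ x, (μ.rnDeriv ν x) ^ q ∂ν)
  else if 1 < q then ⊤
  else
    (((q - 1)⁻¹ : ℝ) : EReal) *
      ENNReal.log (∫⁻ x, (μ.rnDeriv (μ + ν) x) ^ q * (ν.rnDeriv (μ + ν) x) ^ (1 - q) ∂(μ + ν))

/-- The constant `(1 - L²) / (4h (L^{-2N} - 1))`, for `L ≥ 0` and `N ≥ 1`, with its limiting values
`0` at `L = 0` and `1 / (4hN)` at `L = 1`. -/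
def regularityConst (L h : ℝ) (N : ℕ) : ℝ :=
  if L = 0 then 0
  else if L = 1 then 1 / (4 * h * N)
  else (1 - L ^ 2) / (4 * h * (L ^ (-(2 * (N : ℤ))) - 1))

end LangevinRegularity

end


/-! For order `q`, the divergences are read off the Hellinger integrals `∫ f ^ q * g ^ (1 - q)` of
the transition densities. By Hölder's inequality these integrals are jointly convex for `1 < q` and
jointly concave for `0 < q < 1`, so a bound for pairs of starting points passes to mixtures over any
coupling of the initial laws.

For two starting points the bound is proved by induction on the number of steps. The first step
produces Gaussians centered at points `u`, `u'` at distance at most `L ‖x - y‖`. Translating the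
second one by `(1 - η) (u' - u)` before coupling the remaining steps splits the cost into the
Gaussian comparison `η² b ‖u - u'‖²`, `b = 1 / (4 h)`, and the cost `(1 - η)² c ‖u - u'‖²` of the
remaining steps started from points that differ by the translation. The optimal choice
`η = c / (c + b)` gives the recursion `c ↦ L² c b / (c + b)`, which the constant of the theorem
solves.

The Kullback–Leibler bound is the limit `q → 1⁻`, taken through Tsallis entropies and Fatou's lemma.
-/

noncomputable section

namespace LangevinRegularity

section RenyiLE

/-- The comparison of Hellinger-type integrals of order `q` under which `(q - 1)⁻¹ * log` is
monotone: it is `≤` for `1 < q` and `≥` for `q < 1`. It lets both ranges of `q` share one proof. -/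
def RenyiLE (q : ℝ) (A B : ℝ≥0∞) : Prop :=
  (1 < q → A ≤ B) ∧ (q < 1 → B ≤ A)

variable {q : ℝ} {A B C : ℝ≥0∞}

theorem RenyiLE.trans (hAB : RenyiLE q A B) (hBC : RenyiLE q B C) : RenyiLE q A C :=
  ⟨fun hq => (hAB.1 hq).trans (hBC.1 hq), fun hq => (hBC.2 hq).trans (hAB.2 hq)⟩

instance : Trans (RenyiLE q) (RenyiLE q) (RenyiLE q) := ⟨RenyiLE.trans⟩

theorem RenyiLE.mul_left (hAB : RenyiLE q A B) (C : ℝ≥0∞) : RenyiLE q (C * A) (C * B) :=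
  ⟨fun hq => mul_le_mul_right (hAB.1 hq) C, fun hq => mul_le_mul_right (hAB.2 hq) C⟩

theorem RenyiLE.lintegral {Ω : Type*} [MeasurableSpace Ω] {m : Measure Ω} {f g : Ω → ℝ≥0∞}
    (hfg : ∀ x, RenyiLE q (f x) (g x)) : RenyiLE q (∫⁻ x, f x ∂m) (∫⁻ x, g x ∂m) :=
  ⟨fun hq => lintegral_mono fun x => (hfg x).1 hq, fun hq => lintegral_mono fun x => (hfg x).2 hq⟩

theorem RenyiLE.inv_mul_log_le (hAB : RenyiLE q A B) :
    (((q - 1)⁻¹ : ℝ) : EReal) * ENNReal.log A ≤ (((q - 1)⁻¹ : ℝ) : EReal) * ENNReal.log B := by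
  rcases lt_trichotomy q 1 with hq | rfl | hq
  · rw [← neg_sub, inv_neg, EReal.coe_neg, EReal.neg_mul, EReal.neg_mul, EReal.neg_le_neg_iff]
    exact mul_le_mul_of_nonneg_left (ENNReal.log_monotone (hAB.2 hq))
      (EReal.coe_nonneg.2 (inv_nonneg.2 (sub_nonneg.2 hq.le)))
  · simp
  · exact mul_le_mul_of_nonneg_left (ENNReal.log_monotone (hAB.1 hq))
      (EReal.coe_nonneg.2 (inv_nonneg.2 (sub_nonneg.2 hq.le)))

end RenyiLE

section HellingerExp

/-- The value `exp (q (q - 1) s)` of a Hellinger integral of order `q` that corresponds to a Rényi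
divergence equal to `q s`. -/
def hellingerExp (q s : ℝ) : ℝ≥0∞ :=
  ENNReal.ofReal (Real.exp (q * (q - 1) * s))

variable {q s t : ℝ}

@[fun_prop]
theorem measurable_hellingerExp : Measurable (hellingerExp q) := by
  unfold hellingerExp
  fun_prop

theorem hellingerExp_add : hellingerExp q (s + t) = hellingerExp q s * hellingerExp q t := by
  rw [hellingerExp, hellingerExp, hellingerExp, ← ENNReal.ofReal_mul (Real.exp_nonneg _),
    ← Real.exp_add, mul_add]

theorem renyiLE_hellingerExp (hq : 0 ≤ q) (hst : s ≤ t) :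
    RenyiLE q (hellingerExp q s) (hellingerExp q t) := by
  refine ⟨fun hq1 => ?_, fun hq1 => ?_⟩ <;>
    refine ENNReal.ofReal_le_ofReal (Real.exp_le_exp.2 ?_)
  · exact mul_le_mul_of_nonneg_left hst (mul_nonneg hq (sub_nonneg.2 hq1.le))
  · exact mul_le_mul_of_nonpos_left hst (mul_nonpos_of_nonneg_of_nonpos hq (sub_nonpos.2 hq1.le))

theorem one_le_hellingerExp_add (hq : q ≤ 1) (hs : 0 ≤ s) :
    1 ≤ hellingerExp q s + ENNReal.ofReal (1 - q) * ENNReal.ofReal s := by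
  have h1q : 0 ≤ 1 - q := sub_nonneg.2 hq
  rw [hellingerExp, ← ENNReal.ofReal_mul h1q, ← ENNReal.ofReal_add (by positivity) (by positivity),
    ENNReal.one_le_ofReal]
  have := Real.add_one_le_exp (q * (q - 1) * s)
  nlinarith [mul_nonneg (mul_nonneg h1q h1q) hs]

end HellingerExp

section HellingerIntegral

variable {α Ω : Type*} [MeasurableSpace α] [MeasurableSpace Ω] {γ : Measure α} {m : Measure Ω}
  {q : ℝ}

/-- The Hellinger integral `∫ f ^ q * g ^ (1 - q)` of order `q` of two densities with respect to
`m`. -/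
def hellingerIntegral (q : ℝ) (m : Measure Ω) (f g : Ω → ℝ≥0∞) : ℝ≥0∞ :=
  ∫⁻ x, f x ^ q * g x ^ (1 - q) ∂m

theorem hellingerIntegral_const_mul {a b : ℝ≥0∞} (ha₀ : a ≠ 0) (ha : a ≠ ∞) (hb₀ : b ≠ 0)
    (hb : b ≠ ∞) (f g : Ω → ℝ≥0∞) :
    hellingerIntegral q m (fun x => a * f x) (fun x => b * g x) =
      a ^ q * b ^ (1 - q) * hellingerIntegral q m f g := by
  have mul_rpow {c : ℝ≥0∞} (hc₀ : c ≠ 0) (hc : c ≠ ∞) (r : ℝ) (t : ℝ≥0∞) :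
      (c * t) ^ r = c ^ r * t ^ r := by
    simp [ENNReal.mul_rpow_eq_ite, hc₀, hc]
  rw [hellingerIntegral, hellingerIntegral,
    ← lintegral_const_mul' _ _ (ENNReal.mul_ne_top (ENNReal.rpow_ne_top_of_ne_zero ha₀ ha)
      (ENNReal.rpow_ne_top_of_ne_zero hb₀ hb))]
  refine lintegral_congr fun x => ?_
  rw [mul_rpow ha₀ ha, mul_rpow hb₀ hb, mul_mul_mul_comm]

theorem hellingerIntegral_le_rpow_lintegral_mul {f g : α → ℝ≥0∞} (hf : AEMeasurable f γ)
    (hg : AEMeasurable g γ) (hq₀ : 0 ≤ q) (hq : q ≤ 1) :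
    hellingerIntegral q γ f g ≤ (∫⁻ x, f x ∂γ) ^ q * (∫⁻ x, g x ∂γ) ^ (1 - q) :=
  ENNReal.lintegral_mul_norm_pow_le hf hg hq₀ (sub_nonneg.2 hq) (add_sub_cancel q 1)

theorem rpow_lintegral_le_hellingerIntegral_mul {f g : α → ℝ≥0∞} (hf : AEMeasurable f γ)
    (hg : AEMeasurable g γ) (hq : 1 < q) (hg_top : ∫⁻ x, g x ∂γ ≠ ∞)
    (hfg : hellingerIntegral q γ f g ≠ ∞) :
    (∫⁻ x, f x ∂γ) ^ q ≤ hellingerIntegral q γ f g * (∫⁻ x, g x ∂γ) ^ (q - 1) := by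
  have hq₀ : 0 < q := one_pos.trans hq
  have hq_inv : 0 < 1 - q⁻¹ := sub_pos.2 (inv_lt_one_of_one_lt₀ hq)
  have hfg_meas : AEMeasurable (fun x => f x ^ q * g x ^ (1 - q)) γ := by fun_prop
  have factor : ∀ᵐ x ∂γ, f x = (f x ^ q * g x ^ (1 - q)) ^ q⁻¹ * g x ^ (1 - q⁻¹) := by
    filter_upwards [ae_lt_top' hg hg_top, ae_lt_top' hfg_meas hfg] with x hgx hfgx
    rcases eq_or_ne (g x) 0 with hg0 | hg0
    · rw [hg0, ENNReal.zero_rpow_of_neg (sub_neg.2 hq)] at hfgx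
      have hf0 : f x = 0 := by
        by_contra hf0
        simp [ENNReal.mul_top, hf0, hq₀.le, not_lt.2] at hfgx
      simp [hf0, hg0, hq_inv]
    · rw [ENNReal.mul_rpow_of_nonneg _ _ (by positivity), ← ENNReal.rpow_mul, ← ENNReal.rpow_mul,
        mul_inv_cancel₀ hq₀.ne', ENNReal.rpow_one, mul_assoc, ← ENNReal.rpow_add _ _ hg0 hgx.ne,
        show (1 - q) * q⁻¹ + (1 - q⁻¹) = 0 by field_simp; ring, ENNReal.rpow_zero, mul_one]
  calc (∫⁻ x, f x ∂γ) ^ q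
      = (∫⁻ x, (f x ^ q * g x ^ (1 - q)) ^ q⁻¹ * g x ^ (1 - q⁻¹) ∂γ) ^ q := by
        rw [lintegral_congr_ae factor]
    _ ≤ (hellingerIntegral q γ f g ^ q⁻¹ * (∫⁻ x, g x ∂γ) ^ (1 - q⁻¹)) ^ q := by
        gcongr
        exact ENNReal.lintegral_mul_norm_pow_le hfg_meas hg (by positivity) hq_inv.le
          (add_sub_cancel _ 1)
    _ = hellingerIntegral q γ f g * (∫⁻ x, g x ∂γ) ^ (q - 1) := by
        rw [ENNReal.mul_rpow_of_nonneg _ _ hq₀.le, ← ENNReal.rpow_mul, ← ENNReal.rpow_mul,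
          inv_mul_cancel₀ hq₀.ne', ENNReal.rpow_one,
          show (1 - q⁻¹) * q = q - 1 by field_simp]

theorem rpow_lintegral_mul_le_hellingerIntegral {f g : α → ℝ≥0∞} (hf : AEMeasurable f γ)
    (hg : AEMeasurable g γ) (hq : 1 < q) :
    (∫⁻ x, f x ∂γ) ^ q * (∫⁻ x, g x ∂γ) ^ (1 - q) ≤ hellingerIntegral q γ f g := by
  by_cases hfg : hellingerIntegral q γ f g = ∞
  · exact hfg ▸ le_top
  by_cases hg_top : ∫⁻ x, g x ∂γ = ∞
  · simp [hg_top, ENNReal.top_rpow_of_neg (sub_neg.2 hq)]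
  calc (∫⁻ x, f x ∂γ) ^ q * (∫⁻ x, g x ∂γ) ^ (1 - q)
      ≤ hellingerIntegral q γ f g * (∫⁻ x, g x ∂γ) ^ (q - 1) * (∫⁻ x, g x ∂γ) ^ (1 - q) := by
        gcongr
        exact rpow_lintegral_le_hellingerIntegral_mul hf hg hq hg_top hfg
    _ ≤ hellingerIntegral q γ f g * 1 := by
        rw [mul_assoc]
        gcongr
        rw [← neg_sub q 1, ENNReal.rpow_neg]
        exact ENNReal.mul_inv_le_one _
    _ = hellingerIntegral q γ f g := mul_one _

theorem renyiLE_hellingerIntegral {f g : α → ℝ≥0∞} (hf : AEMeasurable f γ)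
    (hg : AEMeasurable g γ) (hq : 0 ≤ q) :
    RenyiLE q ((∫⁻ x, f x ∂γ) ^ q * (∫⁻ x, g x ∂γ) ^ (1 - q)) (hellingerIntegral q γ f g) :=
  ⟨rpow_lintegral_mul_le_hellingerIntegral hf hg,
    fun hq1 => hellingerIntegral_le_rpow_lintegral_mul hf hg hq hq1.le⟩

theorem renyiLE_hellingerIntegral_mixture [SFinite γ] [SFinite m] {f g : α → Ω → ℝ≥0∞}
    (hf : Measurable (Function.uncurry f)) (hg : Measurable (Function.uncurry g)) (hq : 0 ≤ q) :
    RenyiLE q (hellingerIntegral q m (fun z => ∫⁻ r, f r z ∂γ) (fun z => ∫⁻ r, g r z ∂γ))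
      (∫⁻ r, hellingerIntegral q m (f r) (g r) ∂γ) := by
  have hswap : ∫⁻ r, hellingerIntegral q m (f r) (g r) ∂γ =
      ∫⁻ z, hellingerIntegral q γ (fun r => f r z) (fun r => g r z) ∂m :=
    lintegral_lintegral_swap ((hf.pow_const q).mul (hg.pow_const (1 - q))).aemeasurable
  rw [hswap]
  exact RenyiLE.lintegral fun z => renyiLE_hellingerIntegral hf.of_uncurry_right.aemeasurable
    hg.of_uncurry_right.aemeasurable hq

end HellingerIntegral

section Divergence

variable {Ω : Type*} [MeasurableSpace Ω] {m : Measure Ω} {f g : Ω → ℝ≥0∞} {q : ℝ}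

theorem withDensity_eq_withDensity_withDensity_div (hf : Measurable f) (hg : Measurable g)
    (hg₀ : ∀ᵐ x ∂m, g x ≠ 0) (hg_top : ∀ᵐ x ∂m, g x ≠ ∞) :
    m.withDensity f = (m.withDensity g).withDensity (fun x => f x / g x) := by
  refine Eq.trans (withDensity_congr_ae ?_) (withDensity_mul _ hg (hf.div hg))
  filter_upwards [hg₀, hg_top] with x hx₀ hx_top
  exact (ENNReal.mul_div_cancel hx₀ hx_top).symm

theorem withDensity_absolutelyContinuous_withDensity (hf : Measurable f) (hg : Measurable g)
    (hg₀ : ∀ᵐ x ∂m, g x ≠ 0) (hg_top : ∀ᵐ x ∂m, g x ≠ ∞) :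
    m.withDensity f ≪ m.withDensity g := by
  rw [withDensity_eq_withDensity_withDensity_div hf hg hg₀ hg_top]
  exact withDensity_absolutelyContinuous _ _

theorem lintegral_rnDeriv_rpow_withDensity [SigmaFinite m] (hf : Measurable f)
    (hg : Measurable g) (hg₀ : ∀ᵐ x ∂m, g x ≠ 0) (hg_top : ∀ᵐ x ∂m, g x ≠ ∞) (hq : 0 ≤ q) :
    ∫⁻ x, ((m.withDensity f).rnDeriv (m.withDensity g) x) ^ q ∂(m.withDensity g) =
      hellingerIntegral q m f g := by
  have : SigmaFinite (m.withDensity g) := SigmaFinite.withDensity_of_ne_top hg_top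
  have hderiv : (m.withDensity f).rnDeriv (m.withDensity g) =ᵐ[m.withDensity g]
      fun x => f x / g x := by
    rw [withDensity_eq_withDensity_withDensity_div hf hg hg₀ hg_top]
    exact Measure.rnDeriv_withDensity _ (hf.div hg)
  calc ∫⁻ x, ((m.withDensity f).rnDeriv (m.withDensity g) x) ^ q ∂(m.withDensity g)
      = ∫⁻ x, (f x / g x) ^ q ∂(m.withDensity g) :=
        lintegral_congr_ae (hderiv.mono fun x hx => congrArg (· ^ q) hx)
    _ = ∫⁻ x, g x * (f x / g x) ^ q ∂m :=
        lintegral_withDensity_eq_lintegral_mul _ hg (by fun_prop)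
    _ = hellingerIntegral q m f g := by
        refine lintegral_congr_ae ?_
        filter_upwards [hg₀, hg_top] with x hx₀ hx_top
        rw [ENNReal.div_rpow_of_nonneg _ _ hq, ENNReal.rpow_sub _ _ hx₀ hx_top, ENNReal.rpow_one,
          ← mul_div_assoc, ← mul_div_assoc, mul_comm]

theorem renyiDiv_withDensity [SigmaFinite m] (hf : Measurable f) (hg : Measurable g)
    (hg₀ : ∀ᵐ x ∂m, g x ≠ 0) (hg_top : ∀ᵐ x ∂m, g x ≠ ∞) (hq₀ : 0 ≤ q) (hq : q ≠ 1) :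
    renyiDiv q (m.withDensity f) (m.withDensity g) =
      (((q - 1)⁻¹ : ℝ) : EReal) * ENNReal.log (hellingerIntegral q m f g) := by
  rw [renyiDiv, if_neg hq,
    if_pos (withDensity_absolutelyContinuous_withDensity hf hg hg₀ hg_top),
    lintegral_rnDeriv_rpow_withDensity hf hg hg₀ hg_top hq₀]

/-- The generator of the Tsallis relative entropy of order `q`, normalized like `klFun`, to which
it converges as `q → 1`. -/
def tsallisFun (q t : ℝ) : ℝ :=
  (t - t ^ q) / (1 - q) - t + 1

@[fun_prop]
theorem measurable_tsallisFun : Measurable (tsallisFun q) := by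
  unfold tsallisFun
  fun_prop

theorem tsallisFun_nonneg {t : ℝ} (ht : 0 ≤ t) (hq₀ : 0 ≤ q) (hq : q < 1) :
    0 ≤ tsallisFun q t := by
  have h1q : 0 < 1 - q := sub_pos.2 hq
  have young : t ^ q ≤ q * t + (1 - q) := by
    simpa using Real.geom_mean_le_arith_mean2_weighted hq₀ h1q.le ht zero_le_one (by ring)
  have : t - 1 ≤ (t - t ^ q) / (1 - q) := by
    rw [le_div_iff₀ h1q]
    linarith
  rw [tsallisFun]
  linarith

theorem tendsto_tsallisFun_klFun {t : ℝ} (ht : 0 ≤ t) :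
    Filter.Tendsto (fun q => tsallisFun q t) (nhdsWithin 1 (Set.Iio 1)) (nhds (klFun t)) := by
  rcases ht.eq_or_lt with rfl | ht
  · refine Filter.Tendsto.congr' ?_ (tendsto_const_nhds (x := klFun 0))
    filter_upwards [Ioo_mem_nhdsLT one_pos] with q hq
    simp [klFun, tsallisFun, Real.zero_rpow hq.1.ne']
  have hderiv : HasDerivAt (fun q : ℝ => t ^ q) (t * Real.log t) 1 := by
    simpa using (Real.hasStrictDerivAt_const_rpow ht 1).hasDerivAt
  have hslope := (hasDerivAt_iff_tendsto_slope.1 hderiv).mono_left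
    (nhdsWithin_mono 1 fun q (hq : q < 1) => hq.ne)
  rw [show klFun t = t * Real.log t - t + 1 by rw [klFun]; ring]
  refine ((hslope.sub_const t).add_const 1).congr fun q => ?_
  rw [slope_def_field, Real.rpow_one, tsallisFun, ← neg_div_neg_eq, neg_sub, neg_sub]

variable {μ ν : Measure Ω} [IsProbabilityMeasure μ] [IsProbabilityMeasure ν]

theorem lintegral_tsallisFun_add_lintegral_rnDeriv_rpow (hμν : μ ≪ ν) (hq₀ : 0 ≤ q)
    (hq : q < 1) :
    ENNReal.ofReal (1 - q) * (∫⁻ x, ENNReal.ofReal (tsallisFun q (μ.rnDeriv ν x).toReal) ∂ν) +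
      ∫⁻ x, (μ.rnDeriv ν x) ^ q ∂ν = 1 := by
  have h1q : 0 < 1 - q := sub_pos.2 hq
  have pointwise : ∀ᵐ x ∂ν,
      ENNReal.ofReal (1 - q) * ENNReal.ofReal (tsallisFun q (μ.rnDeriv ν x).toReal) +
        (μ.rnDeriv ν x) ^ q = ENNReal.ofReal q * μ.rnDeriv ν x + ENNReal.ofReal (1 - q) := by
    filter_upwards [μ.rnDeriv_lt_top ν] with x hx
    lift μ.rnDeriv ν x to NNReal using hx.ne with t
    have hF := tsallisFun_nonneg t.coe_nonneg hq₀ hq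
    rw [ENNReal.coe_toReal, ← ENNReal.ofReal_coe_nnreal,
      ENNReal.ofReal_rpow_of_nonneg t.coe_nonneg hq₀, ← ENNReal.ofReal_mul h1q.le,
      ← ENNReal.ofReal_mul hq₀, ← ENNReal.ofReal_add (by positivity) (by positivity),
      ← ENNReal.ofReal_add (by positivity) h1q.le, tsallisFun]
    congr 1
    field_simp
    ring
  rw [← lintegral_const_mul _ (by fun_prop), ← lintegral_add_right _ (by fun_prop),
    lintegral_congr_ae pointwise, lintegral_add_right _ (by fun_prop),
    lintegral_const_mul _ (by fun_prop), Measure.lintegral_rnDeriv hμν, lintegral_const,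
    measure_univ, measure_univ, mul_one, mul_one, ← ENNReal.ofReal_add hq₀ h1q.le]
  simp

theorem lintegral_tsallisFun_le (hμν : μ ≪ ν) (hq₀ : 0 ≤ q) (hq : q < 1) {K : ℝ≥0∞}
    (hK : 1 ≤ ∫⁻ x, (μ.rnDeriv ν x) ^ q ∂ν + ENNReal.ofReal (1 - q) * K) :
    ∫⁻ x, ENNReal.ofReal (tsallisFun q (μ.rnDeriv ν x).toReal) ∂ν ≤ K := by
  have htotal := lintegral_tsallisFun_add_lintegral_rnDeriv_rpow hμν hq₀ hq
  have hfin : ∫⁻ x, (μ.rnDeriv ν x) ^ q ∂ν ≠ ∞ := fun h => by simp [h] at htotal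
  rw [← htotal, add_comm, ENNReal.add_le_add_iff_left hfin] at hK
  exact (ENNReal.mul_le_mul_iff_right (by simpa using hq) ENNReal.ofReal_ne_top).1 hK

theorem klDiv_le_of_forall_lt_one (hμν : μ ≪ ν) {K : ℝ≥0∞}
    (hK : ∀ q : ℝ, 0 < q → q < 1 →
      1 ≤ ∫⁻ x, (μ.rnDeriv ν x) ^ q ∂ν + ENNReal.ofReal (1 - q) * K) :
    klDiv μ ν ≤ K := by
  have hlim : ∀ x, ENNReal.ofReal (klFun (μ.rnDeriv ν x).toReal) =
      Filter.liminf (fun q => ENNReal.ofReal (tsallisFun q (μ.rnDeriv ν x).toReal))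
        (nhdsWithin 1 (Set.Iio 1)) := fun x =>
    ((ENNReal.continuous_ofReal.tendsto _).comp
      (tendsto_tsallisFun_klFun ENNReal.toReal_nonneg)).liminf_eq.symm
  rw [klDiv_eq_lintegral_klFun_of_ac hμν]
  simp only [hlim]
  refine (lintegral_liminf_le fun q => by fun_prop).trans
    (Filter.liminf_le_of_frequently_le' (Filter.Eventually.frequently ?_))
  filter_upwards [Ioo_mem_nhdsLT one_pos] with q hq
  exact lintegral_tsallisFun_le hμν hq.1.le hq.2 (hK q hq.1 hq.2)

end Divergence

section Kernel

variable {Ω Ω' : Type*} [MeasurableSpace Ω] [MeasurableSpace Ω'] {m : Measure Ω'}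

theorem measurable_uncurry_comp {α : Type*} [MeasurableSpace α] {p : Ω → Ω' → ℝ≥0∞}
    (hp : Measurable (Function.uncurry p)) {φ : α → Ω} (hφ : Measurable φ) :
    Measurable (Function.uncurry fun a z => p (φ a) z) :=
  hp.comp (hφ.prodMap measurable_id)

theorem bind_eq_withDensity [SFinite m] {κ : Kernel Ω Ω'} {p : Ω → Ω' → ℝ≥0∞}
    (hp : Measurable (Function.uncurry p)) (hκ : ∀ x, κ x = m.withDensity (p x))
    (μ : Measure Ω) [SFinite μ] :
    μ.bind κ = m.withDensity (fun z => ∫⁻ x, p x z ∂μ) := by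
  ext s hs
  rw [Measure.bind_apply hs κ.aemeasurable, withDensity_apply _ hs]
  simp_rw [hκ, withDensity_apply _ hs]
  exact lintegral_lintegral_swap hp.aemeasurable

instance isMarkovKernel_pow (κ : Kernel Ω Ω) [IsMarkovKernel κ] (n : ℕ) :
    IsMarkovKernel (κ ^ n) := by
  induction n with
  | zero => exact inferInstanceAs (IsMarkovKernel Kernel.id)
  | succ n ih =>
    rw [pow_succ]
    exact inferInstanceAs (IsMarkovKernel ((κ ^ n) ∘ₖ κ))

/-- The density with respect to `m` of `n + 1` steps of the Markov chain whose one-step transition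
density is `p`. -/
def iterDensity (m : Measure Ω) (p : Ω → Ω → ℝ≥0∞) : ℕ → Ω → Ω → ℝ≥0∞
  | 0 => p
  | n + 1 => fun x z => ∫⁻ w, p x w * iterDensity m p n w z ∂m

variable {m : Measure Ω} {p : Ω → Ω → ℝ≥0∞}

theorem measurable_iterDensity [SFinite m] (hp : Measurable (Function.uncurry p)) (n : ℕ) :
    Measurable (Function.uncurry (iterDensity m p n)) := by
  induction n with
  | zero => exact hp
  | succ n ih =>
    refine Measurable.lintegral_prod_right'
      (f := fun r : (Ω × Ω) × Ω => p r.1.1 r.2 * iterDensity m p n r.2 r.1.2) ?_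
    exact (hp.comp (measurable_fst.fst.prodMk measurable_snd)).mul
      (ih.comp (measurable_snd.prodMk measurable_fst.snd))

theorem lintegral_ne_zero_of_forall_ne_zero [NeZero m] {f : Ω → ℝ≥0∞} (hf : Measurable f)
    (hf₀ : ∀ x, f x ≠ 0) : ∫⁻ x, f x ∂m ≠ 0 := by
  rw [Ne, lintegral_eq_zero_iff hf]
  intro h
  obtain ⟨x, hx⟩ := h.exists
  exact hf₀ x hx

theorem iterDensity_ne_zero [SFinite m] [NeZero m] (hp : Measurable (Function.uncurry p))
    (hp₀ : ∀ x z, p x z ≠ 0) (n : ℕ) (x z : Ω) : iterDensity m p n x z ≠ 0 := by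
  induction n generalizing x z with
  | zero => exact hp₀ x z
  | succ n ih =>
    exact lintegral_ne_zero_of_forall_ne_zero
      (hp.of_uncurry_left.mul (measurable_iterDensity hp n).of_uncurry_right)
      fun w => mul_ne_zero (hp₀ x w) (ih w z)

theorem pow_succ_eq_withDensity_iterDensity [SFinite m] (hp : Measurable (Function.uncurry p))
    {κ : Kernel Ω Ω} (hκ : ∀ x, κ x = m.withDensity (p x)) (n : ℕ) (x : Ω) :
    (κ ^ (n + 1)) x = m.withDensity (iterDensity m p n x) := by
  induction n generalizing x with
  | zero => rw [zero_add, pow_one, hκ, iterDensity]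
  | succ n ih =>
    have hcomp : (κ ^ (n + 1 + 1)) x = (κ x).bind (κ ^ (n + 1)) := by
      rw [pow_succ]
      exact Kernel.comp_apply _ _ _
    have hn := measurable_iterDensity (m := m) hp n
    rw [hcomp, hκ, bind_eq_withDensity hn ih]
    congr with z
    exact lintegral_withDensity_eq_lintegral_mul _ hp.of_uncurry_left hn.of_uncurry_right

end Kernel

section Coupling

variable {Ω Ω' : Type*} [MeasurableSpace Ω] [MeasurableSpace Ω'] {μ ν : Measure Ω}
  {γ : Measure (Ω × Ω)} {q : ℝ}

theorem isProbabilityMeasure_of_mem_couplings [IsProbabilityMeasure μ]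
    (hγ : γ ∈ couplings μ ν) : IsProbabilityMeasure γ :=
  have : IsProbabilityMeasure (γ.map Prod.fst) := hγ.1 ▸ inferInstance
  Measure.isProbabilityMeasure_of_map Prod.fst

theorem prod_mem_couplings [IsProbabilityMeasure μ] [IsProbabilityMeasure ν] :
    μ.prod ν ∈ couplings μ ν := by
  simp [couplings]

variable {m : Measure Ω'} {κ : Kernel Ω Ω'} {p : Ω → Ω' → ℝ≥0∞} {c : Ω × Ω → ℝ}

theorem renyiLE_hellingerIntegral_of_mem_couplings [SFinite m] [SFinite γ]
    (hp : Measurable (Function.uncurry p)) (hq : 0 ≤ q)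
    (hpc : ∀ r : Ω × Ω, RenyiLE q (hellingerIntegral q m (p r.1) (p r.2)) (hellingerExp q (c r)))
    (hγ : γ ∈ couplings μ ν) :
    RenyiLE q (hellingerIntegral q m (fun z => ∫⁻ x, p x z ∂μ) (fun z => ∫⁻ y, p y z ∂ν))
      (∫⁻ r, hellingerExp q (c r) ∂γ) := by
  simp only [← hγ.1, ← hγ.2, lintegral_map hp.of_uncurry_right measurable_fst,
    lintegral_map hp.of_uncurry_right measurable_snd]
  exact (renyiLE_hellingerIntegral_mixture (measurable_uncurry_comp hp measurable_fst)
    (measurable_uncurry_comp hp measurable_snd) hq).trans (RenyiLE.lintegral hpc)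

theorem ae_lintegral_density_ne_top [SFinite m] [IsMarkovKernel κ]
    (hp : Measurable (Function.uncurry p)) (hκ : ∀ x, κ x = m.withDensity (p x))
    [IsFiniteMeasure ν] : ∀ᵐ z ∂m, ∫⁻ x, p x z ∂ν ≠ ∞ := by
  have hν : Measurable fun z => ∫⁻ x, p x z ∂ν := hp.lintegral_prod_left'
  refine (ae_lt_top hν ?_).mono fun z hz => hz.ne
  rw [← setLIntegral_univ, ← withDensity_apply _ .univ, ← bind_eq_withDensity hp hκ]
  exact measure_ne_top _ _

variable [SigmaFinite m] [IsMarkovKernel κ] [IsProbabilityMeasure μ] [IsProbabilityMeasure ν]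

theorem renyiDiv_bind_le_of_mem_couplings (hp : Measurable (Function.uncurry p))
    (hp₀ : ∀ x z, p x z ≠ 0) (hκ : ∀ x, κ x = m.withDensity (p x)) (hq₀ : 0 ≤ q) (hq : q ≠ 1)
    (hpc : ∀ r : Ω × Ω, RenyiLE q (hellingerIntegral q m (p r.1) (p r.2)) (hellingerExp q (c r)))
    (hγ : γ ∈ couplings μ ν) :
    renyiDiv q (μ.bind κ) (ν.bind κ) ≤
      (((q - 1)⁻¹ : ℝ) : EReal) * ENNReal.log (∫⁻ r, hellingerExp q (c r) ∂γ) := by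
  have := isProbabilityMeasure_of_mem_couplings hγ
  have hμ : Measurable fun z => ∫⁻ x, p x z ∂μ := hp.lintegral_prod_left'
  have hν : Measurable fun z => ∫⁻ y, p y z ∂ν := hp.lintegral_prod_left'
  rw [bind_eq_withDensity hp hκ, bind_eq_withDensity hp hκ,
    renyiDiv_withDensity hμ hν
      (ae_of_all _ fun z => lintegral_ne_zero_of_forall_ne_zero hp.of_uncurry_right (hp₀ · z))
      (ae_lintegral_density_ne_top hp hκ) hq₀ hq]
  exact (renyiLE_hellingerIntegral_of_mem_couplings hp hq₀ hpc hγ).inv_mul_log_le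

theorem klDiv_bind_le_of_mem_couplings (hp : Measurable (Function.uncurry p))
    (hp₀ : ∀ x z, p x z ≠ 0) (hκ : ∀ x, κ x = m.withDensity (p x)) (hc : Measurable c)
    (hc₀ : ∀ r, 0 ≤ c r)
    (hpc : ∀ q : ℝ, 0 < q → ∀ r : Ω × Ω,
      RenyiLE q (hellingerIntegral q m (p r.1) (p r.2)) (hellingerExp q (c r)))
    (hγ : γ ∈ couplings μ ν) :
    klDiv (μ.bind κ) (ν.bind κ) ≤ ∫⁻ r, ENNReal.ofReal (c r) ∂γ := by
  have := isProbabilityMeasure_of_mem_couplings hγ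
  have hμ : Measurable fun z => ∫⁻ x, p x z ∂μ := hp.lintegral_prod_left'
  have hν : Measurable fun z => ∫⁻ y, p y z ∂ν := hp.lintegral_prod_left'
  have hν₀ : ∀ᵐ z ∂m, ∫⁻ y, p y z ∂ν ≠ 0 :=
    ae_of_all _ fun z => lintegral_ne_zero_of_forall_ne_zero hp.of_uncurry_right (hp₀ · z)
  have hν_top := ae_lintegral_density_ne_top (ν := ν) hp hκ
  have hprob (ρ : Measure Ω) [IsProbabilityMeasure ρ] : IsProbabilityMeasure
      (m.withDensity fun z => ∫⁻ x, p x z ∂ρ) := bind_eq_withDensity hp hκ ρ ▸ inferInstance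
  have := hprob μ
  have := hprob ν
  rw [bind_eq_withDensity hp hκ, bind_eq_withDensity hp hκ]
  refine klDiv_le_of_forall_lt_one
    (withDensity_absolutelyContinuous_withDensity hμ hν hν₀ hν_top) fun q hq₀ hq => ?_
  rw [lintegral_rnDeriv_rpow_withDensity hμ hν hν₀ hν_top hq₀.le]
  calc (1 : ℝ≥0∞) = ∫⁻ _, 1 ∂γ := by simp
    _ ≤ ∫⁻ r, (hellingerExp q (c r) + ENNReal.ofReal (1 - q) * ENNReal.ofReal (c r)) ∂γ :=
        lintegral_mono fun r => one_le_hellingerExp_add hq.le (hc₀ r)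
    _ = ∫⁻ r, hellingerExp q (c r) ∂γ +
          ENNReal.ofReal (1 - q) * ∫⁻ r, ENNReal.ofReal (c r) ∂γ := by
        rw [lintegral_add_left (by fun_prop), lintegral_const_mul _ (by fun_prop)]
    _ ≤ hellingerIntegral q m (fun z => ∫⁻ x, p x z ∂μ) (fun z => ∫⁻ y, p y z ∂ν) +
          ENNReal.ofReal (1 - q) * ∫⁻ r, ENNReal.ofReal (c r) ∂γ := by
        gcongr
        exact (renyiLE_hellingerIntegral_of_mem_couplings hp hq₀.le (hpc q hq₀) hγ).2 hq

theorem wasserstein2_sq {d : ℕ} (μ ν : Measure (EuclideanSpace ℝ (Fin d))) :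
    wasserstein2 μ ν ^ 2 =
      ⨅ γ ∈ couplings μ ν, ∫⁻ r, ENNReal.ofReal (‖r.1 - r.2‖ ^ 2) ∂γ := by
  rw [wasserstein2, ← ENNReal.rpow_natCast, ← ENNReal.rpow_mul]
  norm_num

theorem le_ofReal_mul_wasserstein2_sq {d : ℕ} {μ ν : Measure (EuclideanSpace ℝ (Fin d))}
    [IsProbabilityMeasure μ] [IsProbabilityMeasure ν] {C : ℝ} (hC : 0 ≤ C) {K : ℝ≥0∞}
    (hK : ∀ γ ∈ couplings μ ν, K ≤ ∫⁻ r, ENNReal.ofReal (C * ‖r.1 - r.2‖ ^ 2) ∂γ) :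
    K ≤ ENNReal.ofReal C * wasserstein2 μ ν ^ 2 := by
  have : Nonempty (couplings μ ν) := ⟨_, prod_mem_couplings⟩
  rw [wasserstein2_sq, iInf_subtype', ENNReal.mul_iInf (fun h => (ENNReal.ofReal_ne_top h).elim)]
  refine le_iInf fun γ => (hK γ γ.2).trans_eq ?_
  rw [← lintegral_const_mul _ (by fun_prop)]
  simp only [ENNReal.ofReal_mul hC]

end Coupling

section Gaussian

variable {E : Type*} [NormedAddCommGroup E] [InnerProductSpace ℝ E] {b q : ℝ}

/-- The density `(b / π) ^ (n / 2) * exp (-b ‖z‖ ^ 2)` of the centered Gaussian measure with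
covariance `1 / (2 b)` times the identity on an `n`-dimensional space. -/
def gaussianDensity (b : ℝ) (z : E) : ℝ≥0∞ :=
  ENNReal.ofReal (((Real.pi / b) ^ (Module.finrank ℝ E / 2 : ℝ))⁻¹ * Real.exp (-b * ‖z‖ ^ 2))

theorem gaussianDensity_ne_zero (hb : 0 < b) (z : E) : gaussianDensity b z ≠ 0 := by
  have : 0 < Real.pi / b := by positivity
  rw [gaussianDensity, Ne, ENNReal.ofReal_eq_zero, not_le]
  positivity

theorem gaussianDensity_ne_top (z : E) : gaussianDensity b z ≠ ∞ :=
  ENNReal.ofReal_ne_top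

theorem sq_norm_affine_combination (t : ℝ) (x y : E) :
    ‖t • x + (1 - t) • y‖ ^ 2 = t * ‖x‖ ^ 2 + (1 - t) * ‖y‖ ^ 2 - t * (1 - t) * ‖x - y‖ ^ 2 := by
  rw [norm_add_sq_real, norm_sub_sq_real, real_inner_smul_left, real_inner_smul_right, norm_smul,
    norm_smul, mul_pow, mul_pow, Real.norm_eq_abs, Real.norm_eq_abs, sq_abs, sq_abs]
  ring

theorem gaussianDensity_rpow_mul_rpow (hb : 0 < b) (q : ℝ) (z u u' : E) :
    gaussianDensity b (z - u) ^ q * gaussianDensity b (z - u') ^ (1 - q) =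
      gaussianDensity b (z - (q • u + (1 - q) • u')) * hellingerExp q (b * ‖u - u'‖ ^ 2) := by
  have : 0 < Real.pi / b := by positivity
  have hexponent : -b * ‖z - u‖ ^ 2 * q + -b * ‖z - u'‖ ^ 2 * (1 - q) =
      -b * ‖z - (q • u + (1 - q) • u')‖ ^ 2 + q * (q - 1) * (b * ‖u - u'‖ ^ 2) := by
    have hcomb := sq_norm_affine_combination q (z - u) (z - u')
    rw [show q • (z - u) + (1 - q) • (z - u') = z - (q • u + (1 - q) • u') by module,
      sub_sub_sub_cancel_left, norm_sub_rev u' u] at hcomb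
    rw [hcomb]
    ring
  simp only [gaussianDensity, hellingerExp]
  set c := ((Real.pi / b) ^ (Module.finrank ℝ E / 2 : ℝ))⁻¹
  have hc : 0 < c := by positivity
  rw [ENNReal.ofReal_rpow_of_pos (by positivity), ENNReal.ofReal_rpow_of_pos (by positivity),
    ← ENNReal.ofReal_mul (by positivity), ← ENNReal.ofReal_mul (by positivity),
    Real.mul_rpow hc.le (by positivity), Real.mul_rpow hc.le (by positivity), ← Real.exp_mul,
    ← Real.exp_mul, mul_mul_mul_comm, ← Real.rpow_add hc, add_sub_cancel, Real.rpow_one,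
    ← Real.exp_add, hexponent, Real.exp_add, ← mul_assoc]

variable [MeasurableSpace E] [BorelSpace E]

@[fun_prop]
theorem measurable_gaussianDensity : Measurable (gaussianDensity b : E → ℝ≥0∞) := by
  unfold gaussianDensity
  fun_prop

variable [FiniteDimensional ℝ E]

theorem lintegral_gaussianDensity_sub (hb : 0 < b) (u : E) :
    ∫⁻ z, gaussianDensity b (z - u) = 1 := by
  have hpos : 0 < (Real.pi / b) ^ (Module.finrank ℝ E / 2 : ℝ) := by positivity
  have hval := GaussianFourier.integral_rexp_neg_mul_sq_norm (V := E) hb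
  have hint : Integrable fun z : E => Real.exp (-b * ‖z‖ ^ 2) :=
    .of_integral_ne_zero (hval ▸ hpos.ne')
  rw [lintegral_sub_right_eq_self (gaussianDensity b) u]
  unfold gaussianDensity
  rw [← ofReal_integral_eq_lintegral_ofReal (hint.const_mul _)
    (ae_of_all _ fun z => by positivity), integral_const_mul, hval, inv_mul_cancel₀ hpos.ne',
    ENNReal.ofReal_one]

theorem lintegral_gaussianDensity_rpow_mul_rpow (hb : 0 < b) (q : ℝ) (u u' : E) :
    ∫⁻ z, gaussianDensity b (z - u) ^ q * gaussianDensity b (z - u') ^ (1 - q) =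
      hellingerExp q (b * ‖u - u'‖ ^ 2) := by
  simp only [gaussianDensity_rpow_mul_rpow hb]
  rw [lintegral_mul_const _ (by fun_prop), lintegral_gaussianDensity_sub hb, one_mul]

theorem renyiLE_hellingerIntegral_gaussian_mixture {Ω : Type*} [MeasurableSpace Ω] {m : Measure Ω}
    [SFinite m] {p : E → Ω → ℝ≥0∞} {c : ℝ} (hb : 0 < b) (hp : Measurable (Function.uncurry p))
    (hq : 0 ≤ q)
    (hpc : ∀ x y, RenyiLE q (hellingerIntegral q m (p x) (p y)) (hellingerExp q (c * ‖x - y‖ ^ 2)))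
    (η : ℝ) (u u' : E) :
    RenyiLE q
      (hellingerIntegral q m (fun z => ∫⁻ w, gaussianDensity b (w - u) * p w z)
        (fun z => ∫⁻ w, gaussianDensity b (w - u') * p w z))
      (hellingerExp q (((1 - η) ^ 2 * c + η ^ 2 * b) * ‖u - u'‖ ^ 2)) := by
  set s := (1 - η) • (u' - u)
  have hshift (z : Ω) : ∫⁻ w, gaussianDensity b (w - u') * p w z =
      ∫⁻ w, gaussianDensity b (w - (u' - s)) * p (w + s) z := by
    rw [← lintegral_add_right_eq_self (fun w => gaussianDensity b (w - u') * p w z) s]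
    simp only [sub_sub_eq_add_sub]
  have hf : Measurable (Function.uncurry fun w z => gaussianDensity b (w - u) * p w z) :=
    Measurable.mul (by fun_prop) hp
  have hg : Measurable
      (Function.uncurry fun w z => gaussianDensity b (w - (u' - s)) * p (w + s) z) :=
    Measurable.mul (by fun_prop) (measurable_uncurry_comp hp (measurable_add_const s))
  have hnorm_s : ‖s‖ ^ 2 = (1 - η) ^ 2 * ‖u - u'‖ ^ 2 := by
    rw [norm_smul, mul_pow, Real.norm_eq_abs, sq_abs, norm_sub_rev]
  have hnorm : ‖u - (u' - s)‖ ^ 2 = η ^ 2 * ‖u - u'‖ ^ 2 := by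
    rw [show u - (u' - s) = η • (u - u') by module, norm_smul, mul_pow, Real.norm_eq_abs, sq_abs]
  simp only [hshift]
  calc RenyiLE q _ (∫⁻ w, hellingerIntegral q m (fun z => gaussianDensity b (w - u) * p w z)
        (fun z => gaussianDensity b (w - (u' - s)) * p (w + s) z)) :=
      renyiLE_hellingerIntegral_mixture hf hg hq
    _ = ∫⁻ w, gaussianDensity b (w - u) ^ q * gaussianDensity b (w - (u' - s)) ^ (1 - q) *
          hellingerIntegral q m (p w) (p (w + s)) := by
      simp only [hellingerIntegral_const_mul (gaussianDensity_ne_zero hb _)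
        (gaussianDensity_ne_top _) (gaussianDensity_ne_zero hb _) (gaussianDensity_ne_top _)]
    RenyiLE q _ (∫⁻ w, gaussianDensity b (w - u) ^ q * gaussianDensity b (w - (u' - s)) ^ (1 - q) *
          hellingerExp q (c * ‖s‖ ^ 2)) := by
      refine RenyiLE.lintegral fun w => RenyiLE.mul_left ?_ _
      simpa [norm_neg] using hpc w (w + s)
    _ = hellingerExp q (((1 - η) ^ 2 * c + η ^ 2 * b) * ‖u - u'‖ ^ 2) := by
      rw [lintegral_mul_const _ (by fun_prop), lintegral_gaussianDensity_rpow_mul_rpow hb,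
        ← hellingerExp_add, hnorm, hnorm_s]
      congr 1
      ring

end Gaussian

section CharFun

variable {E : Type*} [NormedAddCommGroup E] [InnerProductSpace ℝ E] [FiniteDimensional ℝ E]
  [MeasurableSpace E] [BorelSpace E] {b : ℝ}

theorem integral_gaussianDensity_smul_cexp_inner (hb : 0 < b) (w : E) :
    ∫ z : E, (gaussianDensity b z).toReal • Complex.exp (inner ℝ z w * Complex.I) =
      Complex.exp (-‖w‖ ^ 2 / (4 * b)) := by
  have hpos : 0 < Real.pi / b := by positivity
  have hscale : ((Real.pi : ℂ) / b) ^ (Module.finrank ℝ E / 2 : ℂ) =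
      ((Real.pi / b) ^ (Module.finrank ℝ E / 2 : ℝ) : ℝ) := by
    rw [Complex.ofReal_cpow hpos.le]
    push_cast
    rfl
  have hscale₀ : (((Real.pi / b) ^ (Module.finrank ℝ E / 2 : ℝ) : ℝ) : ℂ) ≠ 0 :=
    Complex.ofReal_ne_zero.2 (by positivity)
  calc ∫ z : E, (gaussianDensity b z).toReal • Complex.exp (inner ℝ z w * Complex.I)
      = ∫ z : E, (((Real.pi / b) ^ (Module.finrank ℝ E / 2 : ℝ) : ℝ) : ℂ)⁻¹ *
          Complex.exp (-(b : ℂ) * ‖z‖ ^ 2 + Complex.I * inner ℝ w z) := by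
        refine integral_congr_ae (ae_of_all _ fun z => ?_)
        simp only [gaussianDensity]
        rw [ENNReal.toReal_ofReal (by positivity), Complex.real_smul, real_inner_comm,
          Complex.exp_add]
        push_cast
        ring_nf
    _ = Complex.exp (-‖w‖ ^ 2 / (4 * b)) := by
        rw [integral_const_mul,
          GaussianFourier.integral_cexp_neg_mul_sq_norm_add (by simpa using hb), hscale,
          inv_mul_cancel_left₀ hscale₀, Complex.I_sq, neg_one_mul]

theorem charFun_withDensity_gaussianDensity_sub (hb : 0 < b) (x w : E) :
    charFun (volume.withDensity fun z => gaussianDensity b (z - x)) w =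
      Complex.exp (inner ℝ x w * Complex.I - ‖w‖ ^ 2 / (4 * b)) := by
  rw [charFun_apply, integral_withDensity_eq_integral_toReal_smul (by fun_prop)
    (ae_of_all _ fun z => (gaussianDensity_ne_top _).lt_top),
    ← integral_add_right_eq_self _ x]
  simp only [add_sub_cancel_right, inner_add_left, Complex.ofReal_add, add_mul, Complex.exp_add,
    ← smul_mul_assoc]
  rw [integral_mul_const, integral_gaussianDensity_smul_cexp_inner hb, ← Complex.exp_add]
  ring_nf

end CharFun

section HeatKernel

variable {d : ℕ}

open scoped MatrixOrder in
theorem heatKernel_eq_withDensity {t : ℝ} (ht : 0 < t) (x : EuclideanSpace ℝ (Fin d)) :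
    heatKernel d t x = volume.withDensity fun z => gaussianDensity (1 / (2 * t)) (z - x) := by
  have hb : 0 < 1 / (2 * t) := by positivity
  have : IsProbabilityMeasure ((volume : Measure (EuclideanSpace ℝ (Fin d))).withDensity
      fun z => gaussianDensity (1 / (2 * t)) (z - x)) :=
    ⟨by rw [withDensity_apply _ .univ, setLIntegral_univ, lintegral_gaussianDensity_sub hb]⟩
  change multivariateGaussian x (t • (1 : Matrix (Fin d) (Fin d) ℝ)) = _
  refine Measure.ext_of_charFun (funext fun w => ?_)
  have hquad : w.ofLp ⬝ᵥ (t • (1 : Matrix (Fin d) (Fin d) ℝ)).mulVec w.ofLp = t * ‖w‖ ^ 2 := by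
    rw [EuclideanSpace.real_norm_sq_eq, Matrix.smul_mulVec, Matrix.one_mulVec, dotProduct_smul,
      smul_eq_mul]
    simp [dotProduct, sq]
  have ht' : (t : ℂ) ≠ 0 := Complex.ofReal_ne_zero.2 ht.ne'
  rw [charFun_multivariateGaussian (Matrix.PosSemidef.one.smul ht.le),
    charFun_withDensity_gaussianDensity_sub hb, hquad, real_inner_comm]
  congr 2
  push_cast
  field_simp
  ring

instance isMarkovKernel_heatKernel (t : ℝ) : IsMarkovKernel (heatKernel d t) :=
  ⟨fun x => inferInstanceAs (IsProbabilityMeasure (multivariateGaussian x _))⟩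

end HeatKernel

section RegularityConst

variable {L h : ℝ} {N : ℕ}

theorem regularityConst_eq_div_geom_sum (hL : 0 ≤ L) (hN : N ≠ 0) :
    regularityConst L h N = L ^ (2 * N) / (4 * h * ∑ k ∈ Finset.range N, (L ^ 2) ^ k) := by
  unfold regularityConst
  split_ifs with hL₀ hL₁
  · simp [hL₀, hN]
  · simp [hL₁]
  · have hsq : L ^ 2 ≠ 1 := fun e => hL₁ ((pow_eq_one_iff_of_nonneg hL two_ne_zero).1 e)
    have hpow : L ^ (2 * N) ≠ 1 := fun e =>
      hL₁ ((pow_eq_one_iff_of_nonneg hL (by positivity)).1 e)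
    have hzpow : L ^ (-(2 * (N : ℤ))) = (L ^ (2 * N))⁻¹ := by
      rw [zpow_neg]
      norm_cast
    rw [geom_sum_eq hsq, ← pow_mul, hzpow]
    field_simp [sub_ne_zero.2 hsq, sub_ne_zero.2 hpow, sub_ne_zero.2 hpow.symm]
    ring

theorem regularityConst_one (hL : 0 ≤ L) : regularityConst L h 1 = L ^ 2 * (1 / (4 * h)) := by
  simp [regularityConst_eq_div_geom_sum hL, div_eq_mul_inv]

theorem regularityConst_nonneg (hL : 0 ≤ L) (hh : 0 ≤ h) (hN : N ≠ 0) :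
    0 ≤ regularityConst L h N := by
  rw [regularityConst_eq_div_geom_sum hL hN]
  positivity

theorem regularityConst_succ (hL : 0 ≤ L) (hh : 0 < h) (hN : N ≠ 0) :
    regularityConst L h (N + 1) = L ^ 2 * (regularityConst L h N * (1 / (4 * h)) /
      (regularityConst L h N + 1 / (4 * h))) := by
  rw [regularityConst_eq_div_geom_sum hL hN, regularityConst_eq_div_geom_sum hL N.succ_ne_zero,
    Finset.sum_range_succ, ← pow_mul]
  have hsum : 0 < ∑ k ∈ Finset.range N, (L ^ 2) ^ k :=
    Finset.sum_pos' (fun k _ => by positivity) ⟨0, by simpa [Nat.pos_iff_ne_zero] using hN, by simp⟩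
  rw [Nat.mul_succ, pow_add]
  field_simp
  ring

end RegularityConst

section GaussianStep

theorem renyiLE_hellingerExp_of_lipschitzWith {E F : Type*} [SeminormedAddCommGroup E]
    [SeminormedAddCommGroup F] {φ : E → F} {L : NNReal} {q c : ℝ} (hφ : LipschitzWith L φ)
    (hq : 0 ≤ q) (hc : 0 ≤ c) (x y : E) :
    RenyiLE q (hellingerExp q (c * ‖φ x - φ y‖ ^ 2))
      (hellingerExp q ((L : ℝ) ^ 2 * c * ‖x - y‖ ^ 2)) := by
  refine renyiLE_hellingerExp hq ?_
  calc c * ‖φ x - φ y‖ ^ 2 ≤ c * (L * ‖x - y‖) ^ 2 := by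
        gcongr
        exact hφ.norm_sub_le x y
    _ = (L : ℝ) ^ 2 * c * ‖x - y‖ ^ 2 := by ring

variable {E : Type*} [NormedAddCommGroup E] [InnerProductSpace ℝ E]

/-- The transition density `x ↦ N(φ x, (2 b)⁻¹ I)` of the Markov chain that first applies the map
`φ` and then adds Gaussian noise; for `b = 1 / (4 h)` and `φ x = x - h ∇V(x)` it is the density of
`P̂_h`. -/
def gaussianStepDensity (b : ℝ) (φ : E → E) (x z : E) : ℝ≥0∞ :=
  gaussianDensity b (z - φ x)

variable {b q h : ℝ} {φ : E → E} [MeasurableSpace E] [BorelSpace E]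

theorem measurable_gaussianStepDensity [SecondCountableTopology E] (hφ : Measurable φ) :
    Measurable (Function.uncurry (gaussianStepDensity b φ)) :=
  measurable_gaussianDensity.comp (measurable_snd.sub (hφ.comp measurable_fst))

variable [FiniteDimensional ℝ E]

theorem renyiLE_hellingerIntegral_iterDensity {L : NNReal} (hφ : LipschitzWith L φ) (hh : 0 < h)
    (hq : 0 ≤ q) (n : ℕ) (x y : E) :
    RenyiLE q
      (hellingerIntegral q volume
        (iterDensity volume (gaussianStepDensity (1 / (4 * h)) φ) n x)
        (iterDensity volume (gaussianStepDensity (1 / (4 * h)) φ) n y))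
      (hellingerExp q (regularityConst L h (n + 1) * ‖x - y‖ ^ 2)) := by
  have hb : 0 < 1 / (4 * h) := by positivity
  induction n generalizing x y with
  | zero =>
    rw [regularityConst_one L.coe_nonneg]
    have hone := renyiLE_hellingerExp_of_lipschitzWith hφ hq hb.le x y
    rwa [← lintegral_gaussianDensity_rpow_mul_rpow hb] at hone
  | succ n ih =>
    set c := regularityConst L h (n + 1) with hc_def
    set b := 1 / (4 * h) with hb_def
    have hc : 0 ≤ c := regularityConst_nonneg L.coe_nonneg hh.le n.succ_ne_zero
    -- `η = c / (c + b)` minimizes the exponent `(1 - η)² c + η² b`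
    have hη : (1 - c / (c + b)) ^ 2 * c + (c / (c + b)) ^ 2 * b = c * b / (c + b) := by
      field_simp
      ring
    rw [regularityConst_succ L.coe_nonneg hh n.succ_ne_zero, ← hc_def, ← hb_def]
    have hmix := renyiLE_hellingerIntegral_gaussian_mixture hb
      (measurable_iterDensity
        (measurable_gaussianStepDensity hφ.continuous.measurable) n) hq ih
      (c / (c + b)) (φ x) (φ y)
    rw [hη] at hmix
    exact hmix.trans (renyiLE_hellingerExp_of_lipschitzWith hφ hq (by positivity) x y)

end GaussianStep

section GradientStep

theorem norm_le_of_abs_inner_le {E : Type*} [NormedAddCommGroup E] [InnerProductSpace ℝ E]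
    {T : E →L[ℝ] E} (hT : (T : E →ₗ[ℝ] E).IsSymmetric) {L : ℝ} (hL : 0 ≤ L)
    (h : ∀ v, |inner ℝ (T v) v| ≤ L * ‖v‖ ^ 2) : ‖T‖ ≤ L := by
  rw [ContinuousLinearMap.norm_eq_iSup_rayleighQuotient T hT]
  refine Real.iSup_le (fun v => ?_) hL
  rw [ContinuousLinearMap.rayleighQuotient, abs_div, abs_of_nonneg (sq_nonneg ‖v‖)]
  exact div_le_of_le_mul₀ (sq_nonneg _) hL (h v)

variable {d : ℕ} {V : EuclideanSpace ℝ (Fin d) → ℝ} {α β h : ℝ}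

theorem isSymmetric_hessian (hV : Differentiable ℝ V) (hV' : Differentiable ℝ (gradient V))
    (x : EuclideanSpace ℝ (Fin d)) :
    (hessian V x : EuclideanSpace ℝ (Fin d) →ₗ[ℝ] EuclideanSpace ℝ (Fin d)).IsSymmetric := by
  have hV₁ (y : EuclideanSpace ℝ (Fin d)) : HasFDerivAt V (innerSL ℝ (gradient V y)) y :=
    (hV y).hasGradientAt.hasFDerivAt
  have hV₂ : HasFDerivAt (fun y => innerSL ℝ (gradient V y)) ((innerSL ℝ).comp (hessian V x)) x :=
    (innerSL ℝ).hasFDerivAt.comp x (hV' x).hasFDerivAt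
  intro v w
  have hsymm := second_derivative_symmetric hV₁ hV₂ v w
  simp only [ContinuousLinearMap.comp_apply, innerSL_apply_apply] at hsymm
  rwa [real_inner_comm v] at hsymm

theorem norm_id_sub_smul_le {E : Type*} [NormedAddCommGroup E] [InnerProductSpace ℝ E]
    {T : E →L[ℝ] E} (hT : (T : E →ₗ[ℝ] E).IsSymmetric) (hα : ∀ v, α * ‖v‖ ^ 2 ≤ inner ℝ (T v) v)
    (hβ : ∀ v, inner ℝ (T v) v ≤ β * ‖v‖ ^ 2) (hh : 0 ≤ h) :
    ‖ContinuousLinearMap.id ℝ E - h • T‖ ≤ max |1 - h * α| |1 - h * β| := by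
  have hsymm : ((ContinuousLinearMap.id ℝ E - h • T : E →L[ℝ] E) : E →ₗ[ℝ] E).IsSymmetric :=
    LinearMap.IsSymmetric.id.sub (hT.smul (by simp))
  refine norm_le_of_abs_inner_le hsymm (le_max_of_le_left (abs_nonneg _)) fun v => ?_
  have hquad : inner ℝ ((ContinuousLinearMap.id ℝ E - h • T) v) v =
      ‖v‖ ^ 2 - h * inner ℝ (T v) v := by
    simp [inner_sub_left, inner_smul_left]
  rw [hquad, abs_le', neg_sub]
  constructor
  · calc ‖v‖ ^ 2 - h * inner ℝ (T v) v ≤ ‖v‖ ^ 2 - h * (α * ‖v‖ ^ 2) := by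
          gcongr
          exact hα v
      _ = (1 - h * α) * ‖v‖ ^ 2 := by ring
      _ ≤ max |1 - h * α| |1 - h * β| * ‖v‖ ^ 2 := by
          gcongr
          exact (le_abs_self _).trans (le_max_left _ _)
  · calc h * inner ℝ (T v) v - ‖v‖ ^ 2 ≤ h * (β * ‖v‖ ^ 2) - ‖v‖ ^ 2 := by
          gcongr
          exact hβ v
      _ = -(1 - h * β) * ‖v‖ ^ 2 := by ring
      _ ≤ max |1 - h * α| |1 - h * β| * ‖v‖ ^ 2 := by
          gcongr
          exact (neg_le_abs _).trans (le_max_right _ _)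

theorem lipschitzWith_gradientStep (hV : Differentiable ℝ V) (hV' : Differentiable ℝ (gradient V))
    (hα : ∀ x v, α * ‖v‖ ^ 2 ≤ inner ℝ (hessian V x v) v)
    (hβ : ∀ x v, inner ℝ (hessian V x v) v ≤ β * ‖v‖ ^ 2) (hh : 0 ≤ h) {L : NNReal}
    (hL : max |1 - h * α| |1 - h * β| ≤ L) : LipschitzWith L fun x => x - h • gradient V x := by
  have hderiv (x : EuclideanSpace ℝ (Fin d)) : HasFDerivAt (fun x => x - h • gradient V x)
      (ContinuousLinearMap.id ℝ _ - h • hessian V x) x :=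
    (hasFDerivAt_id x).sub ((hV' x).hasFDerivAt.const_smul h)
  refine lipschitzWith_of_nnnorm_fderiv_le (𝕜 := ℝ) (fun x => (hderiv x).differentiableAt)
    fun x => ?_
  rw [(hderiv x).fderiv]
  exact (norm_id_sub_smul_le (isSymmetric_hessian hV hV' x) (hα x) (hβ x) hh).trans hL

end GradientStep

end LangevinRegularity

end

open LangevinRegularity in
theorem theorem3p10_general {d : ℕ} {φ : EuclideanSpace ℝ (Fin d) → EuclideanSpace ℝ (Fin d)}
    {L : NNReal} (hφ : LipschitzWith L φ) {h : ℝ} (hh : 0 < h) {N : ℕ} (hN : 1 ≤ N)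
    {κ : Kernel (EuclideanSpace ℝ (Fin d)) (EuclideanSpace ℝ (Fin d))}
    (hκ : ∀ x, κ x = heatKernel d (2 * h) (φ x))
    (μ ν : Measure (EuclideanSpace ℝ (Fin d))) [IsProbabilityMeasure μ] [IsProbabilityMeasure ν] :
    klDiv (μ.bind ⇑(κ ^ N)) (ν.bind ⇑(κ ^ N)) ≤
        ENNReal.ofReal (regularityConst L h N) * wasserstein2 μ ν ^ 2 ∧
      ∀ q : ℝ, 0 < q → q ≠ 1 →
        renyiDiv q (μ.bind ⇑(κ ^ N)) (ν.bind ⇑(κ ^ N)) ≤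
          ⨅ γ ∈ couplings μ ν, (((q - 1)⁻¹ : ℝ) : EReal) * ENNReal.log (∫⁻ p, ENNReal.ofReal
            (Real.exp (q * (q - 1) * regularityConst L h N * ‖p.1 - p.2‖ ^ 2)) ∂γ) := by
  obtain ⟨n, rfl⟩ := Nat.exists_eq_add_of_le' hN
  have hb : 0 < 1 / (4 * h) := by positivity
  have hp := measurable_gaussianStepDensity (b := 1 / (4 * h)) hφ.continuous.measurable
  have hpn := measurable_iterDensity (m := volume) hp n
  have hpn₀ := iterDensity_ne_zero (m := volume) hp (fun x z => gaussianDensity_ne_zero hb _) n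
  have hκ_density (x) : κ x = volume.withDensity (gaussianStepDensity (1 / (4 * h)) φ x) := by
    rw [hκ, heatKernel_eq_withDensity (by positivity), show 2 * (2 * h) = 4 * h by ring]
    rfl
  have hκn := pow_succ_eq_withDensity_iterDensity hp hκ_density n
  have : IsMarkovKernel κ := ⟨fun x => hκ x ▸ inferInstance⟩
  have hC := regularityConst_nonneg L.coe_nonneg hh.le n.succ_ne_zero
  refine ⟨le_ofReal_mul_wasserstein2_sq hC fun γ hγ => ?_,
    fun q hq₀ hq => le_iInf₂ fun γ hγ => ?_⟩
  · exact klDiv_bind_le_of_mem_couplings hpn hpn₀ hκn (by fun_prop) (fun r => by positivity)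
      (fun q hq r => renyiLE_hellingerIntegral_iterDensity hφ hh hq.le n r.1 r.2) hγ
  · simpa only [hellingerExp, ← mul_assoc] using renyiDiv_bind_le_of_mem_couplings hpn hpn₀ hκn
      hq₀.le hq (fun r => renyiLE_hellingerIntegral_iterDensity hφ hh hq₀.le n r.1 r.2) hγ

theorem theorem3p10 (d : ℕ) (V : EuclideanSpace ℝ (Fin d) → ℝ) (α β h L : ℝ) (N : ℕ)
    (hV : Differentiable ℝ V) (hV' : Differentiable ℝ (gradient V))
    (hα : ∀ x v, α * ‖v‖ ^ 2 ≤ inner ℝ (LangevinRegularity.hessian V x v) v)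
    (hβ : ∀ x v, inner ℝ (LangevinRegularity.hessian V x v) v ≤ β * ‖v‖ ^ 2)
    (hh : 0 < h) (hN : 1 ≤ N) (hL : L = max |1 - h * α| |1 - h * β|)
    (μ ν : Measure (EuclideanSpace ℝ (Fin d))) [IsProbabilityMeasure μ] [IsProbabilityMeasure ν] :
    klDiv (LangevinRegularity.langevinLaw V h N μ)
        (LangevinRegularity.langevinLaw V h N ν)
      ≤ ENNReal.ofReal (LangevinRegularity.regularityConst L h N)
          * LangevinRegularity.wasserstein2 μ ν ^ 2 ∧
    ∀ q : ℝ, 0 < q → q ≠ 1 →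
      LangevinRegularity.renyiDiv q (LangevinRegularity.langevinLaw V h N μ)
          (LangevinRegularity.langevinLaw V h N ν)
        ≤ ⨅ γ ∈ LangevinRegularity.couplings μ ν,
            (((q - 1)⁻¹ : ℝ) : EReal) * ENNReal.log (∫⁻ p, ENNReal.ofReal (Real.exp
              (q * (q - 1) * LangevinRegularity.regularityConst L h N * ‖p.1 - p.2‖ ^ 2)) ∂γ) := by
  lift L to NNReal using hL ▸ le_max_of_le_left (abs_nonneg _)
  exact theorem3p10_general
    (LangevinRegularity.lipschitzWith_gradientStep hV hV' hα hβ hh.le hL.ge) hh hN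
    (fun _ => rfl) μ ν
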